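/- A tournament is an orientation of a complete graph, and the oriented Ramsey number $r(H)$ of an oriented graph $H$ is the smallest integer $N$ such that every tournament on $N$ vertices contains a copy of $H$ (as a not necessarily induced subdigraph). For $k\ge 2$, let $AC_{2k}$ be the antidirected cycle on $2k$ vertices, that is, the cycle of length $2k$ oriented so that any two consecutive edges have opposite directions; thus every vertex has either out-degree $2$ and in-degree $0$, or in-degree $2$ and out-degree $0$. For $\ell\ge 1$, let $Q^{+}(2k,\ell)$ (respectively $Q^{-}(2k,\ell)$) be the oriented graph on $2k+\ell$ vertices obtained from $AC_{2k}$ and a directed path $u_0\to u_1\to\cdots\to u_\ell$ of length $\ell$ by identifying $u_0$ with a vertex of $AC_{2k}$ that has out-degree $2$ (respectively in-degree $2$) on the cycle. **Theorem.** Let $k\ge 54$ and $\ell\ge 1$. Then every tournament on $2k+\ell$ vertices contains a copy of $Q^{+}(2k,\ell)$ and a copy of $Q^{-}(2k,\ell)$, and $$r(Q^{+}(2k,\ell))=r(Q^{-}(2k,\ell))=2k+\ell .$$ -/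

import Mathlib

namespace OrientedRamsey

/-- The out-degree `d⁺(v)`: the number of vertices dominated by `v`. -/
noncomputable def outDegree {V : Type*} (D : Digraph V) (v : V) : ℕ := {w | D.Adj v w}.ncard

/-- The in-degree `d⁻(v)`: the number of vertices dominating `v`. -/
noncomputable def inDegree {V : Type*} (D : Digraph V) (v : V) : ℕ := {w | D.Adj w v}.ncard

/-- A tournament is an orientation of a complete graph: there are no loops, and any two distinct
vertices are joined by exactly one arc. -/
structure IsTournament {V : Type*} (T : Digraph V) : Prop where
  loopless : ∀ a, ¬ T.Adj a a
  adj_iff_not_adj : ∀ a b, a ≠ b → (T.Adj a b ↔ ¬ T.Adj b a)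

/-- `T` contains a copy of `H` (as a not necessarily induced subdigraph). -/
def ContainsCopy {V W : Type*} (T : Digraph W) (H : Digraph V) : Prop :=
  ∃ f : V ↪ W, ∀ a b, H.Adj a b → T.Adj (f a) (f b)

/-- The oriented Ramsey number of `H`: the smallest `N` such that every tournament on `N` vertices
contains a copy of `H`, with value `⊤` if there is no such `N`. -/
noncomputable def orientedRamseyNumber {V : Type*} (H : Digraph V) : ℕ∞ :=
  sInf ((fun N : ℕ => (N : ℕ∞)) ''
    {N : ℕ | ∀ T : Digraph (Fin N), IsTournament T → ContainsCopy T H})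

/-- The antidirected cycle `AC_{2k}` (for `k ≥ 2`): the cycle `0, 1, …, 2k - 1, 0` with every edge
oriented from its even end to its odd end. -/
def antidirectedCycle (k : ℕ) : Digraph (Fin (2 * k)) where
  Adj i j := Even i.val ∧
    (j.val = (i.val + 1) % (2 * k) ∨ i.val = (j.val + 1) % (2 * k))

/-- The directed path on the `n` vertices `0 → 1 → ⋯ → n - 1`. -/
def directedPath (n : ℕ) : Digraph (Fin n) where
  Adj i j := i.val + 1 = j.val

/-- The digraph obtained from the disjoint union of `D` and `E` by identifying the vertex `v` of
`D` with the vertex `u` of `E`; the identified vertex is `Sum.inl v`. -/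
def identify {V W : Type*} (D : Digraph V) (v : V) (E : Digraph W) (u : W) :
    Digraph (V ⊕ {w : W // w ≠ u}) where
  Adj
    | Sum.inl a, Sum.inl b => D.Adj a b ∨ (a = v ∧ b = v ∧ E.Adj u u)
    | Sum.inl a, Sum.inr w => a = v ∧ E.Adj u w
    | Sum.inr w, Sum.inl a => a = v ∧ E.Adj w u
    | Sum.inr w, Sum.inr x => E.Adj w x

/-- The antidirected cycle `AC_{2k}` with a directed path of length `ℓ` leading away from its
vertex `v`. It is `Q⁺(2k, ℓ)` if `v` has out-degree `2` on the cycle, and `Q⁻(2k, ℓ)` if `v` has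
in-degree `2` on the cycle. -/
def cycleWithPath (k ℓ : ℕ) (v : Fin (2 * k)) :
    Digraph (Fin (2 * k) ⊕ {w : Fin (ℓ + 1) // w ≠ 0}) :=
  identify (antidirectedCycle k) v (directedPath (ℓ + 1)) 0

end OrientedRamsey

/-!
# Antidirected cycles with a directed path attached

Let `T` be a tournament on `2k + ℓ` vertices with `k ≥ 54`. Take a median order `v₁, …, vₙ` of `T`,
an order with the maximum number of forward arcs. Its last `ℓ` vertices, beginning with
`w = v_{2k+1}`, form a directed path, and it is enough to find an antidirected cycle spanning
`v₁, …, v_{2k}` with a suitable vertex that dominates `w`.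

*Spanning antidirected cycles* (`exists_spanning_antiPath`). Let `u, u'` be vertices with a set `P`
of 27 common in-neighbours, in a tournament of even order. The cycle ends with
`u' ← d → u`, where `d ∈ P`, so it is enough to find an antidirected path from `u` to some vertex
of `P` covering all vertices but `u'` and one vertex `d` of `P`. By `exists_antiPath_erase`, an
induction on the order, a tournament has an antidirected path missing just one vertex, and one of
any two given vertices can be prescribed as its origin. Each vertex outside `P` dominates at least
half of `P` or is dominated by at least half of `P`. If the class of the former is even, it is the
union of an antidirected path whose two ends are sources and a single vertex; likewise for the
latter with sinks. (One class is odd, which is mended by moving a vertex of `P` to it.) These at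
most four pieces are linked through `P`; each link takes at most four vertices of `P`
(`exists_link`), and a count of the vertices used shows that two candidates remain for continuing
the path into what is left of `P`, where `exists_antiPath_erase` applies once more. All this also
holds with sources and sinks interchanged, and is therefore stated for a type `b : Bool`. A vertex
`u` of in-degree at least 54 always has a suitable companion `u'` among its in-neighbours.

*The attachment.* For a sink as the attachment vertex, `v_{2k}` dominates `w` and has at least `k`
in-neighbours among `v₁, …, v_{2k-1}`, so that it can play the part of `u`. For a source, if `w` has
more than `k` in-neighbours among `v₁, …, v_{2k}` then one of the `k` sources of any spanning cycle
dominates `w`. If it has exactly `k`, moving `w` to the front gives another median order. Either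
the first case occurs after some such steps, or all rotations of the block `v₁, …, v_{2k+1}` are
tight, so that the block spans a regular tournament and each of its vertices may serve as `w`. Then
`w` can be chosen to suit a cycle in which a given vertex of large out-degree is a source
(`exists_source_adj_of_regular`).
-/

namespace OrientedRamsey

/-! ### Antidirected paths -/

section AntidirectedPaths

open scoped Classical

variable {V : Type*} {T : Digraph V}

/-- `Dir T b x y` says that the arc between `x` and `y` leaves `x` if `b = true`, and enters `x` if
`b = false`: it makes `x` a source, respectively a sink, of an antidirected path using it. -/
def Dir (T : Digraph V) (b : Bool) (x y : V) : Prop := if b then T.Adj x y else T.Adj y x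

theorem dir_not {b : Bool} {x y : V} : Dir T (!b) x y ↔ Dir T b y x := by
  cases b <;> simp [Dir]

theorem dir_or (hT : IsTournament T) (b : Bool) {x y : V} (h : x ≠ y) :
    Dir T b x y ∨ Dir T b y x := by
  have := hT.adj_iff_not_adj x y h
  cases b <;> simp [Dir] <;> tauto

theorem Dir.ne (hT : IsTournament T) {b : Bool} {x y : V} (h : Dir T b x y) : x ≠ y := by
  rintro rfl
  have := hT.loopless x
  cases b <;> simp_all [Dir]

/-- `AntiPath T b c x y S`: there is an antidirected path of `T` from `x` to `y` whose vertex set is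
exactly `S`, where `x` is a source of the path if `b = true` and a sink if `b = false`, and `y` is
a source or a sink according to `c` in the same way. A single vertex counts as a path, of either
type. -/
inductive AntiPath (T : Digraph V) : Bool → Bool → V → V → Finset V → Prop
  | single (b : Bool) (x : V) : AntiPath T b b x x {x}
  | cons {b c : Bool} {x y z : V} {S : Finset V} (h : Dir T b x y) (hx : x ∉ S)
      (p : AntiPath T (!b) c y z S) : AntiPath T b c x z (insert x S)

namespace AntiPath

variable {b c d e : Bool} {x y z w : V} {S S' : Finset V}

theorem left_mem (p : AntiPath T b c x y S) : x ∈ S := by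
  cases p <;> simp

theorem right_mem (p : AntiPath T b c x y S) : y ∈ S := by
  induction p with
  | single => simp
  | cons _ _ _ ih => exact Finset.mem_insert_of_mem ih

theorem join (p : AntiPath T b c x y S) (h : Dir T c y z) (q : AntiPath T (!c) d z w S')
    (hS : Disjoint S S') : AntiPath T b d x w (S ∪ S') := by
  induction p with
  | single b x =>
    rw [Finset.singleton_union]
    exact cons h (by simpa using hS) q
  | @cons b c x y' y S h' hx p ih =>
    rw [Finset.insert_union]
    rw [Finset.disjoint_insert_left] at hS
    exact cons h' (by simp [hx, hS.1]) (ih h q hS.2)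

/-- The types of the vertices of an antidirected path alternate. -/
theorem type_eq_iff (p : AntiPath T b c x y S) : b = c ↔ Odd S.card := by
  induction p with
  | single => simp
  | @cons b c x y z S h hx p ih =>
    rw [Finset.card_insert_of_notMem hx, Nat.odd_add_one, ← ih]
    cases b <;> cases c <;> simp

/-- The vertices of an antidirected path, listed along the path. -/
theorem exists_enum (p : AntiPath T b c x y S) :
    ∃ f : ℕ → V, f 0 = x ∧ f (S.card - 1) = y ∧ (Finset.range S.card).image f = S ∧
      ∀ i, i + 1 < S.card → Dir T (b ^^ decide (Odd i)) (f i) (f (i + 1)) := by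
  induction p with
  | single b x => exact ⟨fun _ => x, rfl, rfl, by simp, by simp⟩
  | @cons b c x y z S h hx p ih =>
    obtain ⟨f, h0, hl, him, hd⟩ := ih
    have hpos : 0 < S.card := Finset.card_pos.2 ⟨_, p.left_mem⟩
    refine ⟨fun i => Nat.casesOn i x f, rfl, ?_, ?_, ?_⟩
    · rw [Finset.card_insert_of_notMem hx]
      obtain ⟨m, hm⟩ : ∃ m, S.card = m + 1 := ⟨S.card - 1, by omega⟩
      rw [hm] at hl ⊢
      simpa using hl
    · rw [Finset.card_insert_of_notMem hx]
      conv_rhs => rw [← him]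
      ext v
      simp only [Finset.mem_image, Finset.mem_range, Finset.mem_insert]
      constructor
      · rintro ⟨i, hi, rfl⟩
        cases i with
        | zero => exact Or.inl rfl
        | succ i => exact Or.inr ⟨i, by omega, rfl⟩
      · rintro (rfl | ⟨i, hi, rfl⟩)
        · exact ⟨0, by omega, rfl⟩
        · exact ⟨i + 1, by omega, rfl⟩
    · intro i hi
      rw [Finset.card_insert_of_notMem hx] at hi
      cases i with
      | zero => simpa [h0] using h
      | succ i =>
        have := hd i (by omega)
        by_cases hi' : Odd i
        · simpa [hi', Nat.odd_add_one] using this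
        · simpa [hi', Nat.odd_add_one] using this

end AntiPath

/-- The vertices of `Q` that may follow `x` on an antidirected path where `x` has type `b`. -/
noncomputable def nbrs (T : Digraph V) (b : Bool) (x : V) (Q : Finset V) : Finset V :=
  Q.filter (Dir T b x)

@[simp] theorem mem_nbrs {b : Bool} {x y : V} {Q : Finset V} :
    y ∈ nbrs T b x Q ↔ y ∈ Q ∧ Dir T b x y := by
  simp [nbrs]

theorem nbrs_subset (b : Bool) (x : V) (Q : Finset V) : nbrs T b x Q ⊆ Q :=
  Finset.filter_subset _ _

end AntidirectedPaths

/-! ### Almost spanning antidirected paths -/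

section AlmostSpanning

open scoped Classical

variable {V : Type*} {T : Digraph V}

theorem exists_pair_of_two_le_card {Z : Finset V} (h : 2 ≤ Z.card) :
    ∃ p ∈ Z, ∃ q ∈ Z, p ≠ q := by
  obtain ⟨p, hp, q, hq, hpq⟩ := Finset.one_lt_card.1 h
  exact ⟨p, hp, q, hq, hpq⟩

theorem card_le_nbrs_add_nbrs (hT : IsTournament T) (b : Bool) {x : V} {Q : Finset V}
    (hx : x ∉ Q) : Q.card ≤ (nbrs T b x Q).card + (nbrs T (!b) x Q).card := by
  refine le_trans (Finset.card_le_card ?_) (Finset.card_union_le _ _)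
  intro z hz
  rw [Finset.mem_union, mem_nbrs, mem_nbrs, dir_not]
  rcases dir_or hT b (x := x) (y := z) (by rintro rfl; exact hx hz) with h | h <;> simp [hz, h]

/-- In a tournament on `Q`, of any two vertices `x` and `y` at least one is the origin, with a
prescribed type `b`, of an antidirected path missing just one vertex. -/
theorem exists_antiPath_erase (hT : IsTournament T) (n : ℕ) :
    ∀ (Q : Finset V) (b : Bool) (x y : V), Q.card = n → x ∈ Q → y ∈ Q → x ≠ y →
      ∃ z, (z = x ∨ z = y) ∧ ∃ d ∈ Q, ∃ t c, AntiPath T b c z t (Q.erase d) := by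
  induction n using Nat.strong_induction_on with
  | _ n ih =>
  intro Q b x y hn hx hy hxy
  wlog hd : Dir T b x y generalizing x y
  · obtain ⟨z, hz, h⟩ := this y x hy hx hxy.symm ((dir_or hT b hxy).resolve_left hd)
    exact ⟨z, hz.symm, h⟩
  -- A vertex with two possible successors is an origin by induction.
  have step : ∀ z ∈ Q, 2 ≤ (nbrs T b z (Q.erase z)).card →
      ∃ d ∈ Q, ∃ t c, AntiPath T b c z t (Q.erase d) := by
    intro z hz h2
    obtain ⟨p, hp, q, hq, hpq⟩ := exists_pair_of_two_le_card h2
    rw [mem_nbrs] at hp hq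
    have hc := Finset.card_erase_of_mem hz
    have hQ : 0 < Q.card := Finset.card_pos.2 ⟨z, hz⟩
    obtain ⟨s, hs, d, hdQ, t, c, P⟩ :=
      ih (Q.erase z).card (by omega) (Q.erase z) (!b) p q rfl hp.1 hq.1 hpq
    have hzs : Dir T b z s := by rcases hs with rfl | rfl; exacts [hp.2, hq.2]
    refine ⟨d, Finset.mem_of_mem_erase hdQ, t, c, ?_⟩
    have := AntiPath.cons hzs (by simp) P
    rwa [Finset.erase_right_comm, Finset.insert_erase] at this
    simp [hz, (Finset.ne_of_mem_erase hdQ).symm]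
  by_cases hx2 : 2 ≤ (nbrs T b x (Q.erase x)).card
  · exact ⟨x, Or.inl rfl, step x hx hx2⟩
  by_cases hy2 : 2 ≤ (nbrs T b y (Q.erase y)).card
  · exact ⟨y, Or.inr rfl, step y hy hy2⟩
  refine ⟨x, Or.inl rfl, ?_⟩
  -- Otherwise nearly every other vertex is joined to `y` in the direction needed to continue the
  -- path `x, y`.
  set R := (Q.erase x).erase y with hR
  have hyQ : y ∈ Q.erase x := by simp [hy, hxy.symm]
  have hcR : R.card + 2 = Q.card := by
    have h1 : R.card + 1 = (Q.erase x).card := Finset.card_erase_add_one hyQ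
    have h2 := Finset.card_erase_add_one hx
    omega
  have hnb : R.card ≤ (nbrs T (!b) y R).card + 1 := by
    have h1 := card_le_nbrs_add_nbrs hT b (x := y) (Q := R) (by simp [hR])
    have h2 : (nbrs T b y R).card ≤ (nbrs T b y (Q.erase y)).card := by
      apply Finset.card_le_card
      intro z
      simp only [mem_nbrs, hR, Finset.mem_erase]
      tauto
    omega
  have hQ : insert x (insert y R) = Q := by
    rw [hR, Finset.insert_erase hyQ, Finset.insert_erase hx]
  have hxR : x ∉ insert y R := by simp [hR, hxy]
  have hyR : y ∉ R := by simp [hR]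
  rcases Nat.lt_or_ge R.card 3 with h3 | h3
  · rcases R.eq_empty_or_nonempty with h0 | hne
    · refine ⟨y, hy, x, b, ?_⟩
      have : Q.erase y = {x} := by
        rw [← hQ, h0]
        ext z; simp only [Finset.mem_erase, Finset.mem_insert, Finset.notMem_empty,
          Finset.mem_singleton]
        constructor
        · tauto
        · rintro rfl; exact ⟨hxy, by simp⟩
      rw [this]
      exact .single b x
    · by_cases h1 : R.card = 1
      · obtain ⟨a, ha⟩ := Finset.card_eq_one.1 h1
        have hax : a ∉ ({x, y} : Finset V) := by
          rw [ha] at hxR hyR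
          simp only [Finset.mem_insert, Finset.mem_singleton] at hxR hyR ⊢
          tauto
        refine ⟨a, by rw [← hQ, ha]; simp, y, !b, ?_⟩
        have := AntiPath.cons hd (by simpa using hxy) (.single (!b) y)
        convert this using 1
        rw [← hQ, ha]
        ext z
        simp only [Finset.mem_erase, Finset.mem_insert, Finset.mem_singleton] at hax ⊢
        constructor
        · tauto
        · rintro (rfl | rfl) <;> tauto
      · have h2 : R.card = 2 := by have := Finset.card_pos.2 hne; omega
        obtain ⟨a, ha⟩ : (nbrs T (!b) y R).Nonempty := Finset.card_pos.1 (by omega)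
        rw [mem_nbrs] at ha
        obtain ⟨e, he⟩ := Finset.card_eq_one.1
          (show (R.erase a).card = 1 by rw [Finset.card_erase_of_mem ha.1]; omega)
        have heR : e ∈ R.erase a := by simp [he]
        rw [Finset.mem_erase] at heR
        refine ⟨e, by rw [← hQ]; simp [heR.2], a, b, ?_⟩
        have hRe : R.erase e = {a} := by
          have h := Finset.card_erase_of_mem heR.2
          obtain ⟨a', ha'⟩ := Finset.card_eq_one.1 (show (R.erase e).card = 1 by omega)
          have : a ∈ R.erase e := by simp [ha.1, heR.1.symm]
          rw [ha'] at this ⊢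
          rw [Finset.mem_singleton.1 this]
        have hQe : Q.erase e = insert x (insert y {a}) := by
          rw [← hQ, Finset.erase_insert_of_ne, Finset.erase_insert_of_ne, hRe]
          · rintro rfl; exact hyR heR.2
          · rintro rfl; exact hxR (by simp [heR.2])
        rw [hQe]
        refine .cons hd ?_ (.cons ha.2 ?_ ?_)
        · intro h; apply hxR
          rw [Finset.mem_insert, Finset.mem_singleton] at h
          rcases h with h | h <;> simp [h, ha.1]
        · rw [Finset.mem_singleton]; rintro rfl; exact hyR ha.1
        · rw [Bool.not_not]; exact .single b a
  · obtain ⟨p, hp, q, hq, hpq⟩ := exists_pair_of_two_le_card (Z := nbrs T (!b) y R) (by omega)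
    rw [mem_nbrs] at hp hq
    obtain ⟨s, hs, d, hdR, t, c, P⟩ := ih R.card (by omega) R b p q rfl hp.1 hq.1 hpq
    have hys : Dir T (!b) y s := by rcases hs with rfl | rfl; exacts [hp.2, hq.2]
    refine ⟨d, by rw [← hQ]; simp [hdR], t, c, ?_⟩
    have hQd : Q.erase d = insert x (insert y (R.erase d)) := by
      rw [← hQ, Finset.erase_insert_of_ne, Finset.erase_insert_of_ne]
      · rintro rfl; exact hyR hdR
      · rintro rfl; exact hxR (by simp [hdR])
    rw [hQd]
    refine .cons hd ?_ (.cons hys ?_ (by rwa [Bool.not_not]))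
    · intro h
      apply hxR
      rw [Finset.mem_insert, Finset.mem_erase] at h
      rw [Finset.mem_insert]
      tauto
    · intro h; exact hyR (Finset.mem_of_mem_erase h)

/-- A tournament on an even number of vertices has an antidirected path with both ends of a
prescribed type that misses just one vertex. -/
theorem exists_antiPath_erase_of_even (hT : IsTournament T) {Q : Finset V} (b : Bool)
    (hQ : Even Q.card) (hne : Q.Nonempty) :
    ∃ d ∈ Q, ∃ s t, AntiPath T b b s t (Q.erase d) := by
  have h2 : 2 ≤ Q.card := by
    obtain ⟨m, hm⟩ := hQ
    have := Finset.card_pos.2 hne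
    omega
  obtain ⟨x, hx, y, hy, hxy⟩ := exists_pair_of_two_le_card h2
  obtain ⟨s, -, d, hd, t, c, P⟩ := exists_antiPath_erase hT _ Q b x y rfl hx hy hxy
  have hbc : b = c := by
    rw [P.type_eq_iff, Finset.card_erase_of_mem hd]
    exact Nat.Even.sub_odd (by omega) hQ odd_one
  subst hbc
  exact ⟨d, hd, s, t, P⟩

/-- Some vertex of a tournament has at least half of the others as out-neighbours
(in-neighbours, if `b = false`). -/
theorem exists_card_le_two_mul_nbrs (hT : IsTournament T) (b : Bool) {Q : Finset V}
    (hne : Q.Nonempty) : ∃ p ∈ Q, Q.card ≤ 2 * (nbrs T b p (Q.erase p)).card + 1 := by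
  by_contra! hcon
  have key : ∀ c, ∑ p ∈ Q, (nbrs T c p (Q.erase p)).card =
      ∑ p ∈ Q, (nbrs T (!c) p (Q.erase p)).card := by
    intro c
    simp only [nbrs, Finset.card_filter]
    have h : ∀ e : Bool, ∑ p ∈ Q, ∑ q ∈ Q.erase p, (if Dir T e p q then 1 else 0) =
        ∑ p ∈ Q, ∑ q ∈ Q, (if p ≠ q ∧ Dir T e p q then 1 else 0) := by
      intro e
      refine Finset.sum_congr rfl fun p hp => ?_
      rw [← Finset.sum_erase Q (a := p) (by simp)]
      refine Finset.sum_congr rfl fun q hq => ?_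
      simp [(Finset.ne_of_mem_erase hq).symm]
    rw [h, h, Finset.sum_comm]
    refine Finset.sum_congr rfl fun p _ => Finset.sum_congr rfl fun q _ => ?_
    simp only [dir_not, ne_comm]
  have h1 : ∑ p ∈ Q, (Q.erase p).card ≤
      ∑ p ∈ Q, ((nbrs T b p (Q.erase p)).card + (nbrs T (!b) p (Q.erase p)).card) :=
    Finset.sum_le_sum fun p _ => card_le_nbrs_add_nbrs hT b (by simp)
  rw [Finset.sum_add_distrib, ← key, ← two_mul, Finset.mul_sum] at h1
  have h2 : ∑ p ∈ Q, 2 * (nbrs T b p (Q.erase p)).card < ∑ p ∈ Q, (Q.erase p).card := by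
    refine Finset.sum_lt_sum_of_nonempty hne fun p hp => ?_
    have := hcon p hp
    rw [Finset.card_erase_of_mem hp]
    omega
  omega

end AlmostSpanning

/-! ### Linking paths through a pool of vertices -/

section Connecting

open scoped Classical

variable {V : Type*} {T : Digraph V}

/-- Two sets are joined by an antidirected path with at most three vertices whose ends have the same
type `c`: a common vertex if there is one, and otherwise, for arcs `a a'` and `e e'` inside the two
sets, the arc between `a'` and `e'` together with one of these. -/
theorem exists_connect_same (hT : IsTournament T) (c : Bool) {Z₁ Z₂ : Finset V}
    (h₁ : 2 ≤ Z₁.card) (h₂ : 2 ≤ Z₂.card) :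
    ∃ R ⊆ Z₁ ∪ Z₂, R.card ≤ 3 ∧ ∃ z₁ ∈ Z₁, ∃ z₂ ∈ Z₂, AntiPath T c c z₁ z₂ R := by
  by_cases hd : Disjoint Z₁ Z₂
  · have main : ∀ Z : Finset V, 2 ≤ Z.card → ∃ p ∈ Z, ∃ q ∈ Z, Dir T c p q := by
      intro Z hZ
      obtain ⟨p, hp, q, hq, hpq⟩ := exists_pair_of_two_le_card hZ
      rcases dir_or hT c hpq with h | h
      exacts [⟨p, hp, q, hq, h⟩, ⟨q, hq, p, hp, h⟩]
    obtain ⟨a, ha, a', ha', haa⟩ := main Z₁ h₁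
    obtain ⟨e, he, e', he', hee⟩ := main Z₂ h₂
    have hne : ∀ {u v}, u ∈ Z₁ → v ∈ Z₂ → u ≠ v := fun hu hv =>
      Finset.disjoint_iff_ne.1 hd _ hu _ hv
    have path : ∀ {u w v}, Dir T c u w → Dir T c v w → u ≠ v →
        AntiPath T c c u v (insert u (insert w {v})) := by
      intro u w v huw hvw huv
      refine .cons huw (by simp [huw.ne hT, huv]) (.cons (dir_not.2 hvw) ?_ ?_)
      · simpa using (hvw.ne hT).symm
      · rw [Bool.not_not]; exact .single c v
    rcases dir_or hT c (hne ha' he') with h | h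
    · refine ⟨_, ?_, Finset.card_le_three, a', ha', e, he, path h hee (hne ha' he)⟩
      intro z; simp only [Finset.mem_insert, Finset.mem_singleton, Finset.mem_union]
      rintro (rfl | rfl | rfl) <;> tauto
    · refine ⟨_, ?_, Finset.card_le_three, a, ha, e', he', path haa h (hne ha he')⟩
      intro z; simp only [Finset.mem_insert, Finset.mem_singleton, Finset.mem_union]
      rintro (rfl | rfl | rfl) <;> tauto
  · obtain ⟨z, hz₁, hz₂⟩ := Finset.not_disjoint_iff.1 hd
    exact ⟨{z}, by simp [hz₁], by simp, z, hz₁, z, hz₂, .single c z⟩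

/-- Two sets of size at least three are joined by an antidirected path with at most four vertices
whose ends have different types. -/
theorem exists_connect_diff (hT : IsTournament T) (c : Bool) {Z₁ Z₂ : Finset V}
    (h₁ : 3 ≤ Z₁.card) (h₂ : 3 ≤ Z₂.card) :
    ∃ R ⊆ Z₁ ∪ Z₂, R.card ≤ 4 ∧ ∃ z₁ ∈ Z₁, ∃ z₂ ∈ Z₂, AntiPath T c (!c) z₁ z₂ R := by
  by_cases hd : ∃ z₁ ∈ Z₁, ∃ z₂ ∈ Z₂, Dir T c z₁ z₂
  · obtain ⟨z₁, hz₁, z₂, hz₂, h⟩ := hd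
    refine ⟨insert z₁ {z₂}, ?_, Finset.card_le_two.trans (by norm_num), z₁, hz₁, z₂, hz₂,
      .cons h (by simpa using h.ne hT) (.single _ _)⟩
    intro z; simp only [Finset.mem_insert, Finset.mem_singleton, Finset.mem_union]
    rintro (rfl | rfl) <;> tauto
  · push Not at hd
    -- Now all arcs between `Z₁` and `Z₂` go the other way, so a path of order four does.
    have hI : (Z₁ ∩ Z₂).card ≤ 1 := by
      by_contra! h
      obtain ⟨p, hp, q, hq, hpq⟩ := exists_pair_of_two_le_card h
      rw [Finset.mem_inter] at hp hq
      rcases dir_or hT c hpq with h | h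
      exacts [hd p hp.1 q hq.2 h, hd q hq.1 p hp.2 h]
    have main : ∀ Z : Finset V, 2 ≤ Z.card → ∃ p ∈ Z, ∃ q ∈ Z, Dir T c p q := by
      intro Z hZ
      obtain ⟨p, hp, q, hq, hpq⟩ := exists_pair_of_two_le_card hZ
      rcases dir_or hT c hpq with h | h
      exacts [⟨p, hp, q, hq, h⟩, ⟨q, hq, p, hp, h⟩]
    have hc₁ := Finset.card_sdiff_add_card_inter Z₁ Z₂
    have hc₂ := Finset.card_sdiff_add_card_inter Z₂ Z₁
    rw [Finset.inter_comm] at hc₂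
    obtain ⟨a, ha, a', ha', haa⟩ := main (Z₁ \ Z₂) (by omega)
    obtain ⟨e, he, e', he', hee⟩ := main (Z₂ \ Z₁) (by omega)
    rw [Finset.mem_sdiff] at ha ha' he he'
    have hne : ∀ {u v}, u ∈ Z₁ → v ∉ Z₁ → u ≠ v := by rintro u v hu hv rfl; exact hv hu
    have hea : Dir T c e a' :=
      (dir_or hT c (hne ha'.1 he.2)).resolve_left (hd a' ha'.1 e he.1)
    refine ⟨insert a (insert a' (insert e {e'})), ?_, Finset.card_le_four, a, ha.1, e', he'.1,
      .cons haa ?_ (.cons (dir_not.2 hea) ?_ (.cons (y := e') ?_ ?_ ?_))⟩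
    · intro z; simp only [Finset.mem_insert, Finset.mem_singleton, Finset.mem_union]
      rintro (rfl | rfl | rfl | rfl) <;> tauto
    · simp [haa.ne hT, hne ha.1 he.2, hne ha.1 he'.2]
    · simp [hne ha'.1 he.2, hne ha'.1 he'.2]
    · simpa using hee
    · simpa using hee.ne hT
    · rw [Bool.not_not]; exact .single _ _

end Connecting

/-! ### Spanning antidirected cycles -/

section HamiltonianCycle

open scoped Classical

variable {V : Type*} {T : Digraph V}

theorem card_nbrs_sub_le (b : Bool) (x : V) (P Q : Finset V) :
    (nbrs T b x P).card ≤ (nbrs T b x Q).card + (P \ Q).card := by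
  refine le_trans (Finset.card_le_card ?_) (Finset.card_union_le _ _)
  intro z
  simp only [mem_nbrs, Finset.mem_union, Finset.mem_sdiff]
  tauto

/-- An antidirected path can be prolonged by a further one through a pool `Q` of unused vertices
that contains a few possible neighbours of the two ends to be linked. -/
theorem exists_link (hT : IsTournament T) {a c e c' : Bool} {x y s t : V} {S X Q : Finset V}
    (p : AntiPath T a c x y S) (q : AntiPath T e c' s t X) (hSX : Disjoint S X)
    (hQS : Disjoint Q S) (hQX : Disjoint Q X) (hy : 3 ≤ (nbrs T c y Q).card)
    (hs : 3 ≤ (nbrs T e s Q).card) :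
    ∃ R ⊆ Q, R.card ≤ 4 ∧ (c = e → R.card ≤ 3) ∧ AntiPath T a c' x t (S ∪ (R ∪ X)) := by
  obtain ⟨R, hR, h4, h3, z₁, hz₁, z₂, hz₂, P⟩ : ∃ R ⊆ Q, R.card ≤ 4 ∧ (c = e → R.card ≤ 3) ∧
      ∃ z₁ ∈ nbrs T c y Q, ∃ z₂ ∈ nbrs T e s Q, AntiPath T (!c) (!e) z₁ z₂ R := by
    have hsub := Finset.union_subset (nbrs_subset (T := T) c y Q) (nbrs_subset (T := T) e s Q)
    by_cases h : c = e
    · subst h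
      obtain ⟨R, hR, h3, z₁, hz₁, z₂, hz₂, P⟩ :=
        exists_connect_same hT (!c) (Nat.le_of_succ_le hy) (Nat.le_of_succ_le hs)
      exact ⟨R, hR.trans hsub, by omega, fun _ => h3, z₁, hz₁, z₂, hz₂, P⟩
    · obtain ⟨R, hR, h4, z₁, hz₁, z₂, hz₂, P⟩ := exists_connect_diff hT (!c) hy hs
      refine ⟨R, hR.trans hsub, h4, fun h' => absurd h' h, z₁, hz₁, z₂, hz₂, ?_⟩
      obtain rfl : e = !c := Bool.eq_not_of_ne (Ne.symm h)
      exact P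
  rw [mem_nbrs] at hz₁ hz₂
  refine ⟨R, hR, h4, h3, p.join hz₁.2 (P.join (dir_not.2 hz₂.2) (by rwa [Bool.not_not]) ?_) ?_⟩
  · exact Finset.disjoint_of_subset_left hR hQX
  · exact Finset.disjoint_union_right.2 ⟨(Finset.disjoint_of_subset_left hR hQS).symm, hSX⟩

/-- A whole set `X` of even size, all of whose vertices see half of the pool `P` in the direction
`b`, can be appended to an antidirected path. The set is covered by a path with both ends of type
`b` and a single vertex, so that two links are needed. -/
theorem exists_append_class (hT : IsTournament T) {a b c : Bool} {x y : V} {S X P Q : Finset V}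
    (p : AntiPath T a c x y S) (hX : Even X.card) (hne : X.Nonempty)
    (hXP : ∀ g ∈ X, 13 ≤ (nbrs T b g P).card) (hused : (P \ Q).card ≤ 4)
    (hSX : Disjoint S X) (hQS : Disjoint Q S) (hQX : Disjoint Q X)
    (hy : 3 ≤ (nbrs T c y Q).card) :
    ∃ Q' ⊆ Q, (Q \ Q').card ≤ 7 ∧ ∃ y' ∈ X, AntiPath T a b x y' (S ∪ ((Q \ Q') ∪ X)) := by
  obtain ⟨d, hd, s, t, q⟩ := exists_antiPath_erase_of_even hT b hX hne
  have hXe : X.erase d ⊆ X := Finset.erase_subset _ _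
  have hs := card_nbrs_sub_le (T := T) b s P Q
  have hs' := hXP s (hXe q.left_mem)
  obtain ⟨R, hR, h4, -, p₁⟩ := exists_link hT p q (Finset.disjoint_of_subset_right hXe hSX) hQS
    (Finset.disjoint_of_subset_right hXe hQX) hy (by omega)
  -- the pool left after the first link
  have hQR : Q \ (Q \ R) = R := Finset.sdiff_sdiff_eq_self hR
  have hused' : ∀ g ∈ X, 3 ≤ (nbrs T b g (Q \ R)).card := by
    intro g hg
    have h1 := hXP g hg
    have h2 := card_nbrs_sub_le (T := T) b g P Q
    have h3 := card_nbrs_sub_le (T := T) b g Q (Q \ R)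
    rw [hQR] at h3
    omega
  obtain ⟨R', hR', -, h3, p₂⟩ := exists_link hT (Q := Q \ R) p₁ (AntiPath.single b d) (by
      rw [Finset.disjoint_singleton_right]
      simp only [Finset.mem_union, Finset.mem_erase, not_or]
      exact ⟨fun h => Finset.disjoint_left.1 hSX h hd,
        fun h => Finset.disjoint_left.1 hQX (hR h) hd, by tauto⟩) (by
      rw [Finset.disjoint_left]
      intro z hz
      simp only [Finset.mem_union, Finset.mem_sdiff] at hz ⊢
      have h1 := Finset.disjoint_left.1 hQS hz.1
      have h2 := fun h => Finset.disjoint_left.1 hQX hz.1 (hXe h)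
      tauto) (by
      rw [Finset.disjoint_singleton_right, Finset.mem_sdiff]
      exact fun h => Finset.disjoint_left.1 hQX h.1 hd)
    (hused' t (hXe q.right_mem)) (hused' d hd)
  have hsub : R ∪ R' ⊆ Q := Finset.union_subset hR (hR'.trans Finset.sdiff_subset)
  refine ⟨Q \ (R ∪ R'), Finset.sdiff_subset, ?_, d, hd, ?_⟩
  · rw [Finset.sdiff_sdiff_eq_self hsub]
    have := Finset.card_union_le R R'
    have := h3 rfl
    omega
  · rw [Finset.sdiff_sdiff_eq_self hsub]
    convert p₂ using 1
    ext z
    simp only [Finset.mem_union, Finset.mem_erase, Finset.mem_singleton]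
    by_cases hz : z = d
    · subst hz; simp [hd]
    · simp only [hz]; tauto

/-- The end of the argument: once only a pool `Q` is left, together with `u'`, all whose vertices
are joined to `u` and `u'` in the direction suiting a spanning antidirected cycle, an almost
spanning path of the pool closes the cycle, and its missing vertex goes between `u'` and `u`. -/
theorem exists_antiPath_closing (hT : IsTournament T) {b c : Bool} {u u' y : V} {S Q : Finset V}
    (p : AntiPath T b c u y S) (hQS : Disjoint Q S) (huS : u' ∉ S)
    (hu : ∀ z ∈ Q, Dir T b u z) (hu' : ∀ z ∈ Q, Dir T b u' z)
    (hpar : Odd (S.card + Q.card)) (hy : 2 ≤ (nbrs T c y Q).card) :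
    ∃ d, AntiPath T b (!b) u d (insert u' (S ∪ Q)) ∧ Dir T b u d := by
  obtain ⟨z₁, hz₁, z₂, hz₂, hz⟩ := exists_pair_of_two_le_card hy
  rw [mem_nbrs] at hz₁ hz₂
  obtain ⟨z, hzz, d, hd, t, c', q⟩ :=
    exists_antiPath_erase hT _ Q (!c) z₁ z₂ rfl hz₁.1 hz₂.1 hz
  have hyz : Dir T c y z := by rcases hzz with rfl | rfl; exacts [hz₁.2, hz₂.2]
  have hQe : Q.erase d ⊆ Q := Finset.erase_subset _ _
  have p₁ := p.join hyz q (Finset.disjoint_of_subset_left hQe hQS).symm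
  have hc' : c' = !b := by
    have h1 : (S ∪ Q.erase d).card + 1 = S.card + Q.card := by
      rw [Finset.card_union_of_disjoint (Finset.disjoint_of_subset_left hQe hQS).symm,
        Finset.card_erase_of_mem hd]
      have := Finset.card_pos.2 ⟨d, hd⟩
      omega
    have h2 := p₁.type_eq_iff
    rw [← h1, Nat.odd_add_one] at hpar
    revert h2
    cases b <;> cases c' <;> simp [hpar]
  subst hc'
  have hdS := Finset.disjoint_left.1 hQS hd
  have hne : ∀ z ∈ Q, u' ≠ z := fun z hz => (hu' z hz).ne hT
  have p₂ := p₁.join (dir_not.2 (hu' t (hQe q.right_mem)))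
    (.cons (b := !!b) (by rw [Bool.not_not]; exact hu' d hd) (by simpa using hne d hd)
      (.single _ d)) (by
    rw [Finset.disjoint_left]
    intro z
    simp only [Finset.mem_union, Finset.mem_erase, Finset.mem_insert, Finset.mem_singleton]
    rintro (hz | hz) (rfl | rfl)
    exacts [huS hz, hdS hz, hne _ hz.2 rfl, hz.1 rfl])
  refine ⟨d, ?_, hu d hd⟩
  rw [Bool.not_not] at p₂
  convert p₂ using 1
  ext z
  simp only [Finset.mem_union, Finset.mem_erase, Finset.mem_insert, Finset.mem_singleton]
  by_cases hz : z = d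
  · subst hz; simp [hd]
  · simp only [hz]; tauto

/-- A class `X` whose vertices have the type `b` of `u` can be covered first at a cost of `1 + 3`
vertices of the pool `P`, since all of `P` is joined to `u` in the right direction. -/
theorem exists_cover_first_class (hT : IsTournament T) {b : Bool} {u : V} {P X : Finset V}
    (hP : 13 ≤ P.card) (hu : ∀ z ∈ P, Dir T b u z) (hX : Even X.card)
    (hXP : ∀ g ∈ X, 13 ≤ (nbrs T b g P).card) (huX : u ∉ X) (hPX : Disjoint P X) :
    ∃ Q c y, Q ⊆ P ∧ (P \ Q).card ≤ 4 ∧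
      AntiPath T b c u y (insert u ((P \ Q) ∪ X)) ∧ 13 ≤ (nbrs T c y P).card := by
  have huP : u ∉ P := fun h => (hu u h).ne hT rfl
  have hPX' := Finset.disjoint_left.1 hPX
  rcases X.eq_empty_or_nonempty with rfl | hne
  · refine ⟨P, b, u, subset_rfl, by simp, by simpa using .single b u, ?_⟩
    have : nbrs T b u P = P := by ext z; rw [mem_nbrs]; exact ⟨And.left, fun h => ⟨h, hu z h⟩⟩
    rwa [this]
  · obtain ⟨d, hd, s, t, q⟩ := exists_antiPath_erase_of_even hT b hX hne
    have hXe : X.erase d ⊆ X := Finset.erase_subset _ _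
    -- the end `u` and the path are linked by a single vertex `z`
    obtain ⟨z, hz⟩ : (nbrs T b s P).Nonempty :=
      Finset.card_pos.1 (by have := hXP s (hXe q.left_mem); omega)
    rw [mem_nbrs] at hz
    have hzX := hPX' hz.1
    have p₁ : AntiPath T b b u t (insert u (insert z (X.erase d))) := by
      refine .cons (hu z hz.1) ?_ (.cons (dir_not.2 hz.2) ?_ (by rwa [Bool.not_not]))
      · simp only [Finset.mem_insert, Finset.mem_erase, not_or]
        exact ⟨by rintro rfl; exact huP hz.1, fun h => huX h.2⟩
      · exact fun h => hzX (hXe h)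
    have hPz : P \ (P.erase z) = {z} := by
      ext v; simp only [Finset.mem_sdiff, Finset.mem_erase, Finset.mem_singleton]
      constructor
      · tauto
      · rintro rfl; exact ⟨hz.1, by simp⟩
    have hcand : ∀ g ∈ X, 3 ≤ (nbrs T b g (P.erase z)).card := by
      intro g hg
      have h1 := hXP g hg
      have h2 := card_nbrs_sub_le (T := T) b g P (P.erase z)
      rw [hPz, Finset.card_singleton] at h2
      omega
    obtain ⟨R, hR, -, h3, p₂⟩ := exists_link hT (Q := P.erase z) p₁ (AntiPath.single b d) (by
        rw [Finset.disjoint_singleton_right]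
        simp only [Finset.mem_insert, Finset.mem_erase, not_or]
        exact ⟨by rintro rfl; exact huX hd, by rintro rfl; exact hzX hd, by tauto⟩) (by
        rw [Finset.disjoint_left]
        intro v
        simp only [Finset.mem_insert, Finset.mem_erase, not_or]
        intro hv
        exact ⟨by rintro rfl; exact huP hv.2, hv.1, fun h => hPX' hv.2 h.2⟩) (by
        rw [Finset.disjoint_singleton_right, Finset.mem_erase]
        exact fun h => hPX' h.2 hd)
      (hcand t (hXe q.right_mem)) (hcand d hd)
    have hsub : insert z R ⊆ P :=
      Finset.insert_subset hz.1 (hR.trans (Finset.erase_subset _ _))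
    refine ⟨P \ insert z R, b, d, Finset.sdiff_subset, ?_, ?_, hXP d hd⟩
    · rw [Finset.sdiff_sdiff_eq_self hsub]
      have := Finset.card_insert_le z R
      have := h3 rfl
      omega
    · rw [Finset.sdiff_sdiff_eq_self hsub]
      convert p₂ using 1
      ext v
      simp only [Finset.mem_union, Finset.mem_erase, Finset.mem_singleton, Finset.mem_insert]
      by_cases hv : v = d
      · subst hv; simp [hd]
      · simp only [hv]; tauto

/-- The pool has 26 vertices and every other vertex sees at least 13 of them in a useful direction.
Appending the class `X` costs at most `1 + 3` vertices of the pool and the class `Y` at most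
`4 + 3`, so that `13 - 11 = 2` candidates are left for the last link. -/
theorem exists_antiPath_of_even_classes (hT : IsTournament T) {b : Bool} {u u' : V}
    {P X Y : Finset V} (huu : u ≠ u') (hP : P.card = 26) (hu : ∀ z ∈ P, Dir T b u z)
    (hu' : ∀ z ∈ P, Dir T b u' z) (hX : Even X.card) (hY : Even Y.card)
    (hXP : ∀ g ∈ X, 13 ≤ (nbrs T b g P).card) (hYP : ∀ g ∈ Y, 13 ≤ (nbrs T (!b) g P).card)
    (huX : u ∉ X) (huY : u ∉ Y) (huX' : u' ∉ X) (huY' : u' ∉ Y)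
    (hPX : Disjoint P X) (hPY : Disjoint P Y) (hXY : Disjoint X Y) :
    ∃ d, AntiPath T b (!b) u d (insert u' (insert u (P ∪ X ∪ Y))) ∧ Dir T b u d := by
  have huP : u ∉ P := fun h => (hu u h).ne hT rfl
  have huP' : u' ∉ P := fun h => (hu' u' h).ne hT rfl
  have hPX' := Finset.disjoint_left.1 hPX
  have hPY' := Finset.disjoint_left.1 hPY
  have hXY' := Finset.disjoint_left.1 hXY
  -- cover `X`
  obtain ⟨Q, c, y, hQP, h4, p, hy⟩ :=
    exists_cover_first_class hT (by omega) hu hX hXP huX hPX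
  have hQ : Disjoint Q (insert u ((P \ Q) ∪ X)) := by
    rw [Finset.disjoint_left]
    intro v hv
    simp only [Finset.mem_insert, Finset.mem_union, Finset.mem_sdiff, not_or]
    exact ⟨by rintro rfl; exact huP (hQP hv), by tauto, hPX' (hQP hv)⟩
  -- cover `Y`
  obtain ⟨Q', c', y', hQP', h11, p', hy'⟩ : ∃ Q' c y, Q' ⊆ P ∧ (P \ Q').card ≤ 11 ∧
      AntiPath T b c u y (insert u ((P \ Q') ∪ X ∪ Y)) ∧ 13 ≤ (nbrs T c y P).card := by
    rcases Y.eq_empty_or_nonempty with rfl | hne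
    · exact ⟨Q, c, y, hQP, by omega, by simpa using p, hy⟩
    · obtain ⟨Q', hQ', h7, y', hy', p'⟩ := exists_append_class hT p hY hne hYP h4 (by
          rw [Finset.disjoint_left]
          intro v
          simp only [Finset.mem_insert, Finset.mem_union, Finset.mem_sdiff]
          rintro (rfl | hv | hv)
          exacts [huY, hPY' hv.1, hXY' hv]) hQ
        (Finset.disjoint_of_subset_left hQP hPY) (by
          have := card_nbrs_sub_le (T := T) c y P Q
          omega)
      have hsplit : P \ Q' = (P \ Q) ∪ (Q \ Q') := by
        ext v
        have h1 := @hQP v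
        have h2 := @hQ' v
        simp only [Finset.mem_union, Finset.mem_sdiff]
        tauto
      refine ⟨Q', !b, y', hQ'.trans hQP, ?_, ?_, hYP y' hy'⟩
      · rw [hsplit]
        have := Finset.card_union_le (P \ Q) (Q \ Q')
        omega
      · rw [hsplit]
        convert p' using 1
        ext v
        simp only [Finset.mem_union, Finset.mem_insert]
        tauto
  have hQ'S : Disjoint Q' (insert u ((P \ Q') ∪ X ∪ Y)) := by
    rw [Finset.disjoint_left]
    intro v hv
    simp only [Finset.mem_insert, Finset.mem_union, Finset.mem_sdiff, not_or]
    exact ⟨by rintro rfl; exact huP (hQP' hv), ⟨by tauto, hPX' (hQP' hv)⟩, hPY' (hQP' hv)⟩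
  have hun : insert u ((P \ Q') ∪ X ∪ Y) ∪ Q' = insert u (P ∪ X ∪ Y) := by
    ext v
    have h1 := @hQP' v
    simp only [Finset.mem_union, Finset.mem_insert, Finset.mem_sdiff]
    tauto
  obtain ⟨d, p'', hd⟩ := exists_antiPath_closing (u' := u') hT p' hQ'S (by
      simp only [Finset.mem_insert, Finset.mem_union, Finset.mem_sdiff, not_or]
      exact ⟨huu.symm, ⟨fun h => huP' h.1, huX'⟩, huY'⟩)
    (fun z hz => hu z (hQP' hz)) (fun z hz => hu' z (hQP' hz)) (by
      rw [← Finset.card_union_of_disjoint hQ'S.symm, hun, Finset.card_insert_of_notMem,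
        Finset.card_union_of_disjoint, Finset.card_union_of_disjoint hPX, hP]
      · rw [Nat.even_iff] at hX hY
        rw [Nat.odd_iff]
        omega
      · exact Finset.disjoint_union_left.2 ⟨hPY, hXY⟩
      · simp [huP, huX, huY]) (by
      have := card_nbrs_sub_le (T := T) c' y' P Q'
      omega)
  rw [hun] at p''
  exact ⟨d, p'', hd⟩

/-- The vertices outside the pool `P` are split according to the direction in which they see at
least half of `P`. One of the two classes has odd size, and a vertex `p` of the pool is moved to
it, so that both are even. -/
theorem exists_even_classes (hT : IsTournament T) (b : Bool) {P G : Finset V} (hP : P.card = 27)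
    (hPG : Disjoint P G) (hG : Odd G.card) :
    ∃ p ∈ P, ∃ X Y : Finset V, X ∪ Y = insert p G ∧ Disjoint X Y ∧ Even X.card ∧ Even Y.card ∧
      (∀ g ∈ X, 13 ≤ (nbrs T b g (P.erase p)).card) ∧
      ∀ g ∈ Y, 13 ≤ (nbrs T (!b) g (P.erase p)).card := by
  set X := G.filter (fun g => 14 ≤ (nbrs T b g P).card) with hX
  set Y := G \ X with hY
  have hXG : X ⊆ G := Finset.filter_subset _ _
  have hYG : Y ⊆ G := Finset.sdiff_subset
  have hXYG : X ∪ Y = G := Finset.union_sdiff_of_subset hXG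
  have hXY : Disjoint X Y := Finset.disjoint_sdiff
  have hXP : ∀ g ∈ X, 14 ≤ (nbrs T b g P).card := fun g hg => (Finset.mem_filter.1 hg).2
  have hYP : ∀ g ∈ Y, 14 ≤ (nbrs T (!b) g P).card := by
    intro g hg
    rw [hY, Finset.mem_sdiff, hX, Finset.mem_filter] at hg
    have h1 := card_le_nbrs_add_nbrs hT b (x := g) (Q := P)
      (fun h => Finset.disjoint_left.1 hPG h hg.1)
    have h2 : ¬ 14 ≤ (nbrs T b g P).card := fun h => hg.2 ⟨hg.1, h⟩
    omega
  have hcard : X.card + Y.card = G.card := by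
    rw [← Finset.card_union_of_disjoint hXY, hXYG]
  have hdrop : ∀ (e : Bool) (g p : V), p ∈ P → 14 ≤ (nbrs T e g P).card →
      13 ≤ (nbrs T e g (P.erase p)).card := by
    intro e g p hp hg
    have h1 := card_nbrs_sub_le (T := T) e g P (P.erase p)
    have h2 := Finset.card_sdiff_add_card_eq_card (Finset.erase_subset p P)
    rw [Finset.card_erase_of_mem hp] at h2
    omega
  have hpick : ∀ e : Bool, ∃ p ∈ P, 13 ≤ (nbrs T e p (P.erase p)).card := by
    intro e
    obtain ⟨p, hp, h⟩ := exists_card_le_two_mul_nbrs hT e (Q := P) (Finset.card_pos.1 (by omega))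
    exact ⟨p, hp, by omega⟩
  have hpG : ∀ p ∈ P, p ∉ X ∧ p ∉ Y := fun p hp =>
    have h := Finset.disjoint_left.1 hPG hp
    ⟨fun hx => h (hXG hx), fun hy => h (hYG hy)⟩
  rcases Nat.even_or_odd X.card with hXe | hXo
  · have hYo : Odd Y.card := by
      rw [Nat.odd_iff] at hG ⊢
      rw [Nat.even_iff] at hXe
      omega
    obtain ⟨p, hp, hp13⟩ := hpick (!b)
    refine ⟨p, hp, X, insert p Y, by rw [Finset.union_insert, hXYG],
      Finset.disjoint_insert_right.2 ⟨(hpG p hp).1, hXY⟩, hXe, ?_,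
      fun g hg => hdrop b g p hp (hXP g hg), fun g hg => ?_⟩
    · rw [Finset.card_insert_of_notMem (hpG p hp).2]
      exact hYo.add_one
    · rcases Finset.mem_insert.1 hg with rfl | hg
      exacts [hp13, hdrop _ g p hp (hYP g hg)]
  · have hYe : Even Y.card := by
      rw [Nat.odd_iff] at hG hXo
      rw [Nat.even_iff]
      omega
    obtain ⟨p, hp, hp13⟩ := hpick b
    refine ⟨p, hp, insert p X, Y, by rw [Finset.insert_union, hXYG],
      Finset.disjoint_insert_left.2 ⟨(hpG p hp).2, hXY⟩, ?_, hYe, fun g hg => ?_,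
      fun g hg => hdrop _ g p hp (hYP g hg)⟩
    · rw [Finset.card_insert_of_notMem (hpG p hp).1]
      exact hXo.add_one
    · rcases Finset.mem_insert.1 hg with rfl | hg
      exacts [hp13, hdrop _ g p hp (hXP g hg)]

/-- A tournament of even order has a spanning antidirected cycle through `u`, in which `u` is a
source if `b = true` and a sink if `b = false`, provided that `u` and some other vertex have 27
common out-neighbours, respectively in-neighbours. -/
theorem exists_spanning_antiPath (hT : IsTournament T) {b : Bool} {u u' : V} {S P : Finset V}
    (hS : Even S.card) (huu : u ≠ u') (huS : u ∈ S) (huS' : u' ∈ S) (hPS : P ⊆ S)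
    (hP : P.card = 27) (hu : ∀ z ∈ P, Dir T b u z) (hu' : ∀ z ∈ P, Dir T b u' z) :
    ∃ d, AntiPath T b (!b) u d S ∧ Dir T b u d := by
  have huP : u ∉ P := fun h => (hu u h).ne hT rfl
  have huP' : u' ∉ P := fun h => (hu' u' h).ne hT rfl
  obtain ⟨G, hG⟩ : ∃ G, G = ((S.erase u').erase u) \ P := ⟨_, rfl⟩
  have hGS : insert u' (insert u (P ∪ G)) = S := by
    ext v
    have h1 := @hPS v
    simp only [hG, Finset.mem_insert, Finset.mem_union, Finset.mem_sdiff, Finset.mem_erase]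
    by_cases h2 : v = u
    · subst h2; simp [huS]
    by_cases h3 : v = u'
    · subst h3; simp [huS']
    simp only [h2, h3]; tauto
  have hPG : Disjoint P G := hG ▸ Finset.disjoint_sdiff
  have huG : u ∉ G := by simp [hG]
  have huG' : u' ∉ G := by simp [hG]
  have hGodd : Odd G.card := by
    rw [← hGS, Finset.card_insert_of_notMem, Finset.card_insert_of_notMem,
      Finset.card_union_of_disjoint hPG, hP] at hS
    · rw [Nat.odd_iff]
      rw [Nat.even_iff] at hS
      omega
    · simp [huP, huG]
    · simp [huu.symm, huP', huG']
  obtain ⟨p, hp, X, Y, hXYG, hXY, hXe, hYe, hXP, hYP⟩ := exists_even_classes hT b hP hPG hGodd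
  have hmem : ∀ v, (v ∈ X ∨ v ∈ Y) ↔ (v = p ∨ v ∈ G) := by
    intro v
    rw [← Finset.mem_union, hXYG, Finset.mem_insert]
  have hout : ∀ v, v ∉ P → v ∉ G → v ∉ X ∧ v ∉ Y := by
    intro v hvP hvG
    have h := hmem v
    have : v ≠ p := by rintro rfl; exact hvP hp
    tauto
  have hdis : ∀ v ∈ P.erase p, v ∉ X ∧ v ∉ Y := by
    intro v hv
    rw [Finset.mem_erase] at hv
    have h := hmem v
    have := Finset.disjoint_left.1 hPG hv.2
    tauto
  obtain ⟨d, h, hd⟩ := exists_antiPath_of_even_classes hT (P := P.erase p) huu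
    (by rw [Finset.card_erase_of_mem hp, hP])
    (fun z hz => hu z (Finset.mem_of_mem_erase hz))
    (fun z hz => hu' z (Finset.mem_of_mem_erase hz)) hXe hYe hXP hYP
    (hout u huP huG).1 (hout u huP huG).2 (hout u' huP' huG').1 (hout u' huP' huG').2
    (Finset.disjoint_left.2 fun v hv => (hdis v hv).1)
    (Finset.disjoint_left.2 fun v hv => (hdis v hv).2) hXY
  refine ⟨d, ?_, hd⟩
  convert h using 1
  rw [← hGS, Finset.union_assoc, hXYG, Finset.union_insert,
    ← Finset.insert_union p, Finset.insert_erase hp]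

end HamiltonianCycle

/-! ### Median orders -/

section MedianOrder

open scoped Classical

variable {V : Type*} {T : Digraph V}

/-- The number of forward arcs of `T` with respect to the order in which a list enumerates its
vertices. -/
noncomputable def forwardArcs (T : Digraph V) : List V → ℕ
  | [] => 0
  | a :: l => l.countP (fun b => T.Adj a b) + forwardArcs T l

/-- A median order: an enumeration with the maximum number of forward arcs among its
rearrangements. -/
def IsMedianOrder (T : Digraph V) (l : List V) : Prop :=
  ∀ l', l'.Perm l → forwardArcs T l' ≤ forwardArcs T l

theorem exists_isMedianOrder (T : Digraph V) (l₀ : List V) :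
    ∃ l, l.Perm l₀ ∧ IsMedianOrder T l := by
  obtain ⟨l, hl, hmax⟩ := Finset.exists_max_image l₀.permutations.toFinset (forwardArcs T)
    ⟨l₀, by simp⟩
  rw [List.mem_toFinset, List.mem_permutations] at hl
  exact ⟨l, hl, fun l' hl' => hmax l' (by
    rw [List.mem_toFinset, List.mem_permutations]
    exact hl'.trans hl)⟩

/-- The effect of moving the vertex `w` to the front of a block `l₁`. -/
theorem forwardArcs_move (T : Digraph V) (l₀ l₁ l₂ : List V) (w : V) :
    forwardArcs T (l₀ ++ (l₁ ++ w :: l₂)) + l₁.countP (fun a => T.Adj w a) =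
      forwardArcs T (l₀ ++ (w :: (l₁ ++ l₂))) + l₁.countP (fun a => T.Adj a w) := by
  induction l₀ with
  | nil =>
    induction l₁ with
    | nil => simp
    | cons a l ih =>
      simp only [List.nil_append, List.cons_append, forwardArcs, List.countP_append,
        List.countP_cons] at ih ⊢
      omega
  | cons a l ih =>
    have hp : (l ++ (l₁ ++ w :: l₂)).Perm (l ++ (w :: (l₁ ++ l₂))) :=
      List.perm_middle.append_left l
    simp only [List.cons_append, forwardArcs, hp.countP_eq]
    omega

namespace IsMedianOrder

variable {l₀ l₁ l₂ : List V} {w : V}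

/-- In a median order, every vertex has at least as many in-neighbours as out-neighbours in any
block of vertices just before it. -/
theorem countP_le (h : IsMedianOrder T (l₀ ++ (l₁ ++ w :: l₂))) :
    l₁.countP (fun a => T.Adj w a) ≤ l₁.countP (fun a => T.Adj a w) := by
  have h1 := h (l₀ ++ (w :: (l₁ ++ l₂))) (List.perm_middle.symm.append_left l₀)
  have h2 := forwardArcs_move T l₀ l₁ l₂ w
  omega

/-- In the case of equality, moving the vertex to the front of the block gives another median
order. -/
theorem move (h : IsMedianOrder T (l₁ ++ w :: l₂))
    (he : l₁.countP (fun a => T.Adj a w) ≤ l₁.countP (fun a => T.Adj w a)) :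
    IsMedianOrder T (w :: (l₁ ++ l₂)) := by
  intro l' hl'
  have h1 := h l' (hl'.trans List.perm_middle.symm)
  have h2 := forwardArcs_move T [] l₁ l₂ w
  simp only [List.nil_append] at h2
  omega

theorem adj {a : V} (hT : IsTournament T) (h : IsMedianOrder T (l₀ ++ (a :: w :: l₂)))
    (hne : a ≠ w) : T.Adj a w := by
  have h1 := countP_le (l₁ := [a]) h
  by_contra hc
  have h2 := (hT.adj_iff_not_adj w a hne.symm).2 hc
  simp [hc, h2] at h1

theorem isChain (hT : IsTournament T) {l : List V} (hl : l.Nodup) :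
    ∀ l₀, IsMedianOrder T (l₀ ++ l) → l.IsChain T.Adj := by
  induction l with
  | nil => simp
  | cons a l ih =>
    intro l₀ h
    cases l with
    | nil => simp
    | cons w l =>
      rw [List.isChain_cons_cons]
      refine ⟨h.adj hT ?_, ih hl.of_cons (l₀ ++ [a]) (by simpa using h)⟩
      rintro rfl
      simp at hl

end IsMedianOrder

theorem countP_add_countP (hT : IsTournament T) {l : List V} {w : V} (hw : w ∉ l) :
    l.countP (fun a => T.Adj w a) + l.countP (fun a => T.Adj a w) = l.length := by
  induction l with
  | nil => simp
  | cons a l ih =>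
    simp only [List.mem_cons, not_or] at hw
    have := ih hw.2
    have h := hT.adj_iff_not_adj w a hw.1
    by_cases h' : T.Adj a w
    · have h'' : ¬ T.Adj w a := by tauto
      simp [h', h'']; omega
    · have h'' : T.Adj w a := by tauto
      simp [h', h'']; omega

theorem countP_eq_card_nbrs {l : List V} (hl : l.Nodup) (w : V) (b : Bool) :
    l.countP (fun a => Dir T b w a) = (nbrs T b w l.toFinset).card := by
  rw [nbrs, List.countP_eq_length_filter, ← List.toFinset_card_of_nodup (hl.filter _),
    List.toFinset_filter]
  simp

theorem countP_adj_left {l : List V} (hl : l.Nodup) (w : V) :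
    l.countP (fun a => T.Adj w a) = (nbrs T true w l.toFinset).card := by
  rw [← countP_eq_card_nbrs hl]
  simp [Dir]

theorem countP_adj_right {l : List V} (hl : l.Nodup) (w : V) :
    l.countP (fun a => T.Adj a w) = (nbrs T false w l.toFinset).card := by
  rw [← countP_eq_card_nbrs hl]
  simp [Dir]

/-- If a median order `m ++ l₂` cannot be rearranged so that the last vertex of the first block has
more in-neighbours than out-neighbours in it, then all rotations of the block are median orders. -/
theorem isMedianOrder_rotate {m l₂ : List V} (h : IsMedianOrder T (m ++ l₂))
    (htight : ∀ m' w, (m' ++ [w]).Perm m → IsMedianOrder T (m' ++ w :: l₂) →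
      m'.countP (fun a => T.Adj a w) ≤ m'.countP (fun a => T.Adj w a)) :
    ∀ m₁ m₂, m = m₁ ++ m₂ → IsMedianOrder T (m₂ ++ m₁ ++ l₂) := by
  intro m₁ m₂
  induction m₂ generalizing m₁ with
  | nil => rintro rfl; simpa using h
  | cons w m₂ ih =>
    intro hm
    have h1 := ih (m₁ ++ [w]) (by simpa using hm)
    have h2 : IsMedianOrder T ((m₂ ++ m₁) ++ w :: l₂) := by simpa using h1
    have hp : ((m₂ ++ m₁) ++ [w]).Perm m := by
      rw [hm, List.append_assoc]
      exact List.perm_append_comm.trans (by simp)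
    simpa using h2.move (htight _ _ hp h2)

end MedianOrder

/-! ### Copies of a cycle with a path -/

section Copies

open scoped Classical

variable {V : Type*} {T : Digraph V}

/-- `f 0, f 1, …, f (n - 1)` is an antidirected closed walk of `T`, in which `f 0` is a source if
`b = true` and a sink if `b = false`; it is a cycle if `f` is injective on `{0, …, n - 1}`. -/
def IsAntiCycle (T : Digraph V) (b : Bool) (f : ℕ → V) (n : ℕ) : Prop :=
  ∀ i < n, Dir T (b ^^ decide (Odd i)) (f i) (f ((i + 1) % n))

theorem AntiPath.exists_antiCycle {b : Bool} {u d : V} {S : Finset V} (p : AntiPath T b (!b) u d S)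
    (hd : Dir T b u d) : ∃ f : ℕ → V, f 0 = u ∧ (Finset.range S.card).image f = S ∧
      IsAntiCycle T b f S.card := by
  obtain ⟨f, h0, hl, him, hf⟩ := p.exists_enum
  refine ⟨f, h0, him, fun i hi => ?_⟩
  rcases Nat.lt_or_ge (i + 1) S.card with h | h
  · rw [Nat.mod_eq_of_lt h]
    exact hf i h
  · have hi' : i + 1 = S.card := by omega
    have heven : ¬ Odd S.card := by
      rw [← p.type_eq_iff]
      cases b <;> simp
    have hodd : Odd i := by
      rw [← hi', Nat.odd_add_one, not_not] at heven
      exact heven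
    have hil : i = S.card - 1 := by omega
    rw [hi', Nat.mod_self, h0, hil, hl, ← hil]
    simpa [hodd, dir_not] using hd

/-- Spanning antidirected cycles exist as soon as `u` has 54 out-neighbours (in-neighbours, if
`b = false`), since one of them is joined in the same direction to 27 of the others. -/
theorem exists_antiCycle (hT : IsTournament T) {b : Bool} {u : V} {S : Finset V}
    (hS : Even S.card) (hu : u ∈ S) (h : 54 ≤ (nbrs T b u S).card) :
    ∃ f : ℕ → V, f 0 = u ∧ (Finset.range S.card).image f = S ∧ IsAntiCycle T b f S.card := by
  obtain ⟨u', hu', h27⟩ := exists_card_le_two_mul_nbrs hT b (Q := nbrs T b u S)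
    (Finset.card_pos.1 (by omega))
  obtain ⟨P, hP, hPc⟩ := Finset.exists_subset_card_eq
    (show 27 ≤ (nbrs T b u' ((nbrs T b u S).erase u')).card by omega)
  have hmem : ∀ z ∈ P, (z ≠ u' ∧ z ∈ S ∧ Dir T b u z) ∧ Dir T b u' z := by
    intro z hz
    simpa using hP hz
  rw [mem_nbrs] at hu'
  obtain ⟨d, p, hd⟩ := exists_spanning_antiPath hT hS (hu'.2.ne hT) hu hu'.1
    (fun z hz => (hmem z hz).1.2.1) hPc (fun z hz => (hmem z hz).1.2.2) fun z hz => (hmem z hz).2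
  exact p.exists_antiCycle hd

/-- A spanning antidirected cycle of a set `S` together with a directed path outside `S` that is
entered from the cycle's vertex `f i₀` gives a copy of the cycle with a path attached. -/
theorem containsCopy_cycleWithPath {k : ℕ} {b : Bool} {f : ℕ → V} {S : Finset V} {i₀ : ℕ}
    {w : V} {l : List V} (v : Fin (2 * k)) (hS : S.card = 2 * k)
    (him : (Finset.range (2 * k)).image f = S) (hf : IsAntiCycle T b f (2 * k))
    (hi₀ : i₀ < 2 * k) (hv : (b ^^ decide (Odd i₀)) = decide (Even v.val))
    (hw : T.Adj (f i₀) w) (hl : (w :: l).Nodup) (hchain : (w :: l).IsChain T.Adj)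
    (hdisj : ∀ z ∈ w :: l, z ∉ S) :
    ContainsCopy T (cycleWithPath k (l.length + 1) v) := by
  have hinj : Set.InjOn f (Finset.range (2 * k)) := by
    rw [← Finset.card_image_iff, him, hS, Finset.card_range]
  have hvk := v.isLt
  set σ : ℕ → ℕ := fun j => (j + (i₀ + (2 * k - v.val))) % (2 * k) with hσ
  have hσlt : ∀ j, σ j < 2 * k := fun j => Nat.mod_lt _ (by omega)
  have hσv : σ v.val = i₀ := by
    have : v.val + (i₀ + (2 * k - v.val)) = i₀ + 2 * k := by omega
    simp only [hσ, this, Nat.add_mod_right]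
    exact Nat.mod_eq_of_lt hi₀
  have hσs : ∀ j, (σ j + 1) % (2 * k) = σ ((j + 1) % (2 * k)) := by
    intro j
    simp only [hσ, Nat.mod_add_mod]
    congr 1
    omega
  have hσ2 : ∀ j, (b ^^ decide (Odd (σ j))) = decide (Even j) := by
    intro j
    have h1 : σ j % 2 = (j + (i₀ + (2 * k - v.val))) % 2 :=
      Nat.mod_mod_of_dvd _ (Dvd.intro k rfl)
    simp only [Nat.odd_iff, Nat.even_iff, h1] at hv ⊢
    rcases Nat.mod_two_eq_zero_or_one i₀ with h2 | h2 <;>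
    rcases Nat.mod_two_eq_zero_or_one v.val with h3 | h3 <;>
    rcases Nat.mod_two_eq_zero_or_one j with h4 | h4 <;>
    · have h5 : (j + (i₀ + (2 * k - v.val))) % 2 = (j % 2 + i₀ % 2 + v.val % 2) % 2 := by omega
      rw [h5]
      simp_all
  have hσinj : ∀ i j : Fin (2 * k), σ i.val = σ j.val → i = j := by
    intro i j h
    have h1 : i.val ≡ j.val [MOD 2 * k] := Nat.ModEq.add_right_cancel' _ h
    exact Fin.ext (Nat.ModEq.eq_of_lt_of_lt h1 i.isLt j.isLt)
  have hfS : ∀ j, f (σ j) ∈ S := by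
    intro j
    rw [← him]
    exact Finset.mem_image_of_mem _ (Finset.mem_range.2 (hσlt j))
  have hpos : ∀ x : {x : Fin (l.length + 1 + 1) // x ≠ 0}, 1 ≤ x.1.val := by
    rintro ⟨x, hx⟩
    exact Nat.one_le_iff_ne_zero.2 fun h => hx (Fin.ext h)
  have hlt : ∀ x : {x : Fin (l.length + 1 + 1) // x ≠ 0}, x.1.val - 1 < (w :: l).length := by
    intro x
    have := x.1.isLt
    have := hpos x
    simp only [List.length_cons]
    omega
  refine ⟨⟨Sum.elim (fun j => f (σ j.val)) (fun x => (w :: l)[x.1.val - 1]'(hlt x)), ?_⟩, ?_⟩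
  · rintro (i | x) (j | y) h
    · simp only [Sum.elim_inl] at h
      rw [hσinj i j (hinj (by simpa using hσlt _) (by simpa using hσlt _) h)]
    · simp only [Sum.elim_inl, Sum.elim_inr] at h
      exact absurd (h ▸ hfS i.val) (hdisj _ (List.getElem_mem _))
    · simp only [Sum.elim_inl, Sum.elim_inr] at h
      exact absurd (h ▸ hfS j.val) (hdisj _ (List.getElem_mem _))
    · simp only [Sum.elim_inr] at h
      have h1 := (hl.getElem_inj_iff).1 h
      have h2 := hpos x
      have h3 := hpos y
      rw [Subtype.ext (Fin.ext (by omega : x.1.val = y.1.val))]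
  · rintro (i | x) (j | y) h
    · change T.Adj (f (σ i.val)) (f (σ j.val))
      rcases h with h | h
      · obtain ⟨he, h | h⟩ := h
        · have h1 := hf (σ i.val) (hσlt _)
          rw [hσ2, hσs, ← h, decide_eq_true he] at h1
          simpa [Dir] using h1
        · have h1 := hf (σ j.val) (hσlt _)
          have ho : ¬ Even j.val := by
            have h2 : i.val % 2 = (j.val + 1) % 2 := by
              rw [h]; exact Nat.mod_mod_of_dvd _ (Dvd.intro k rfl)
            rw [Nat.even_iff] at he ⊢
            omega
          rw [hσ2, hσs, ← h, decide_eq_false ho] at h1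
          simpa [Dir] using h1
      · exact absurd h.2.2 (by simp [directedPath])
    · obtain ⟨rfl, h⟩ := h
      change T.Adj (f (σ i.val)) ((w :: l)[y.1.val - 1]'(hlt y))
      have hy : y.1.val = 1 := by simpa [directedPath] using h.symm
      simpa [hσv, hy] using hw
    · exact absurd h.2 (by simp [directedPath])
    · change T.Adj ((w :: l)[x.1.val - 1]'(hlt x)) ((w :: l)[y.1.val - 1]'(hlt y))
      have hxy : x.1.val + 1 = y.1.val := h
      have hx := hpos x
      have h1 := List.isChain_iff_getElem.1 hchain (x.1.val - 1) (by have := hlt y; omega)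
      have h2 : x.1.val - 1 + 1 = y.1.val - 1 := by omega
      simpa only [h2] using h1

end Copies

/-! ### Cycles entering a median order's tail -/

section MedianCycle

open scoped Classical

variable {V : Type*} {T : Digraph V} {k : ℕ}

theorem toFinset_card_concat {m : List V} {v : V} (hk : 1 ≤ k) (hm : m.length = 2 * k - 1)
    (hl : (m ++ [v]).Nodup) : (m ++ [v]).toFinset.card = 2 * k := by
  rw [List.toFinset_card_of_nodup hl, List.length_append, List.length_singleton]
  omega

/-- The first `2 * k` vertices of a median order are spanned by an antidirected cycle in which the
last of them, having at least half of the others as in-neighbours, is a sink. -/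
theorem exists_antiCycle_of_isMedianOrder (hT : IsTournament T) (hk : 54 ≤ k) {m l : List V}
    {v : V} (h : IsMedianOrder T (m ++ v :: l)) (hl : (m ++ v :: l).Nodup)
    (hm : m.length = 2 * k - 1) :
    ∃ f : ℕ → V, f 0 = v ∧ (Finset.range (2 * k)).image f = (m ++ [v]).toFinset ∧
      IsAntiCycle T false f (2 * k) := by
  have hl' : (m ++ [v]).Nodup := by
    rw [List.append_cons] at hl
    exact hl.of_append_left
  have hvm : v ∉ m := by
    rw [List.nodup_append] at hl'
    intro hv
    exact hl'.2.2 v hv v (by simp) rfl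
  have hc : (m ++ [v]).toFinset.card = 2 * k := toFinset_card_concat (by omega) hm hl'
  have h1 := h.countP_le (l₀ := [])
  have h2 := countP_add_countP hT hvm
  rw [countP_adj_right hl'.of_append_left] at h1 h2
  have h3 : (nbrs T false v m.toFinset).card ≤ (nbrs T false v (m ++ [v]).toFinset).card := by
    apply Finset.card_le_card
    intro z
    simp only [mem_nbrs, List.mem_toFinset, List.mem_append]
    tauto
  have := exists_antiCycle hT (b := false) (u := v) (S := (m ++ [v]).toFinset)
    (by rw [hc]; exact even_two_mul k) (by simp) (by omega)
  rwa [hc] at this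

/-- If the vertex `w` next in the median order has more in-neighbours than out-neighbours among
the first `2 * k` vertices, then it is dominated by one of the `k` sources of their cycle. -/
theorem exists_source_adj (hT : IsTournament T) (hk : 54 ≤ k) {m l : List V} {w : V}
    (h : IsMedianOrder T (m ++ w :: l)) (hl : (m ++ w :: l).Nodup) (hm : m.length = 2 * k)
    (hlt : m.countP (fun a => T.Adj w a) < m.countP (fun a => T.Adj a w)) :
    ∃ f : ℕ → V, (Finset.range (2 * k)).image f = m.toFinset ∧ IsAntiCycle T false f (2 * k) ∧
      ∃ i < 2 * k, Odd i ∧ T.Adj (f i) w := by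
  obtain ⟨m, v, rfl⟩ : ∃ m' v, m = m' ++ [v] :=
    ⟨m.dropLast, m.getLast (by rintro rfl; rw [List.length_nil] at hm; omega),
      (List.dropLast_append_getLast _).symm⟩
  have hm' : m.length = 2 * k - 1 := by
    simp only [List.length_append, List.length_singleton] at hm
    omega
  obtain ⟨f, -, him, hf⟩ := exists_antiCycle_of_isMedianOrder hT hk
    (m := m) (v := v) (l := w :: l) (by simpa using h) (by simpa using hl) hm'
  refine ⟨f, him, hf, ?_⟩
  by_contra! hcon
  have hw : w ∉ m ++ [v] := fun hw => (List.nodup_append.1 hl).2.2 w hw w (by simp) rfl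
  have hnd := hl.of_append_left
  have hc : (m ++ [v]).toFinset.card = 2 * k := toFinset_card_concat (by omega) hm' hnd
  have hinj : Set.InjOn f (Finset.range (2 * k)) := by
    rw [← Finset.card_image_iff, him, hc, Finset.card_range]
  have h1 := countP_add_countP hT hw
  rw [countP_adj_left hnd] at h1 hlt
  have h2 : ((Finset.range k).image fun i => f (2 * i + 1)) ⊆
      nbrs T true w (m ++ [v]).toFinset := by
    intro z hz
    obtain ⟨i, hi, rfl⟩ := Finset.mem_image.1 hz
    rw [Finset.mem_range] at hi
    have hmem : f (2 * i + 1) ∈ (m ++ [v]).toFinset := by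
      rw [← him]
      exact Finset.mem_image_of_mem f (Finset.mem_range.2 (by omega))
    rw [mem_nbrs]
    refine ⟨hmem, ?_⟩
    have hne : w ≠ f (2 * i + 1) := by
      intro he
      exact hw (List.mem_toFinset.1 (he ▸ hmem))
    simpa [Dir] using (hT.adj_iff_not_adj _ _ hne).2 (hcon _ (by omega) (odd_two_mul_add_one i))
  have h3 := Finset.card_le_card h2
  rw [Finset.card_image_of_injOn, Finset.card_range] at h3
  · omega
  · intro i hi j hj hij
    rw [Finset.coe_range, Set.mem_Iio] at hi hj
    have := hinj (by simp; omega) (by simp; omega) hij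
    omega

/-- In a regular tournament on `2 * k + 1` vertices, some vertex `w` is dominated by a source of a
spanning antidirected cycle of the others. The vertices `u₁` and `u₂` are chosen with many common
out-neighbours, and `w` as an out-neighbour of `u₂` which is not one of `u₁`. -/
theorem exists_source_adj_of_regular (hT : IsTournament T) (hk : 54 ≤ k) {M : Finset V}
    (hM : M.card = 2 * k + 1) (hreg : ∀ x ∈ M, (nbrs T true x M).card = k) :
    ∃ w ∈ M, ∃ f : ℕ → V, (Finset.range (2 * k)).image f = M.erase w ∧
      IsAntiCycle T true f (2 * k) ∧ T.Adj (f 0) w := by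
  obtain ⟨u₁, hu₁⟩ : M.Nonempty := Finset.card_pos.1 (by omega)
  set N := nbrs T true u₁ M with hN
  have hNc : N.card = k := hreg u₁ hu₁
  obtain ⟨u₂, hu₂, h27⟩ := exists_card_le_two_mul_nbrs hT true (Q := N)
    (Finset.card_pos.1 (by omega))
  have hu₂' := hu₂
  rw [hN, mem_nbrs] at hu₂'
  obtain ⟨P, hP, hPc⟩ := Finset.exists_subset_card_eq
    (show 27 ≤ (nbrs T true u₂ (N.erase u₂)).card by omega)
  obtain ⟨w, hw, hwN⟩ : ∃ w ∈ nbrs T true u₂ M, w ∉ N := by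
    by_contra! hcon
    have h1 : nbrs T true u₂ M ⊆ N.erase u₂ := fun z hz =>
      Finset.mem_erase.2 ⟨((mem_nbrs.1 hz).2.ne hT).symm, hcon z hz⟩
    have h2 := Finset.card_le_card h1
    rw [hreg u₂ hu₂'.1, Finset.card_erase_of_mem hu₂] at h2
    omega
  rw [mem_nbrs] at hw
  have hmem : ∀ z ∈ P, (z ≠ u₂ ∧ z ∈ N) ∧ Dir T true u₂ z := by
    intro z hz
    simpa only [mem_nbrs, Finset.mem_erase] using hP hz
  have h12 : u₁ ≠ u₂ := hu₂'.2.ne hT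
  have hw₁ : u₁ ≠ w := by
    rintro rfl
    have h1 : T.Adj u₁ u₂ := by simpa [Dir] using hu₂'.2
    have h2 : T.Adj u₂ u₁ := by simpa [Dir] using hw.2
    exact (hT.adj_iff_not_adj _ _ h12).1 h1 h2
  have hcard : (M.erase w).card = 2 * k := by rw [Finset.card_erase_of_mem hw.1, hM]; omega
  obtain ⟨d, p, hd⟩ := exists_spanning_antiPath hT (b := true) (S := M.erase w) (P := P)
    (by rw [hcard]; exact even_two_mul k) h12.symm
    (Finset.mem_erase.2 ⟨hw.2.ne hT, hu₂'.1⟩) (Finset.mem_erase.2 ⟨hw₁, hu₁⟩)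
    (fun z hz => Finset.mem_erase.2 ⟨by rintro rfl; exact hwN (hmem _ hz).1.2,
      (mem_nbrs.1 (hmem z hz).1.2).1⟩) hPc
    (fun z hz => (hmem z hz).2) (fun z hz => (mem_nbrs.1 (hmem z hz).1.2).2)
  obtain ⟨f, h0, him, hf⟩ := p.exists_antiCycle hd
  rw [hcard] at him hf
  refine ⟨w, hw.1, f, him, hf, ?_⟩
  rw [h0]
  simpa [Dir] using hw.2

theorem exists_medianOrder_split [Fintype V] (T : Digraph V) {n r : ℕ}
    (hV : Fintype.card V = n + (r + 1)) :
    ∃ (m : List V) (w : V) (l : List V), m.length = n ∧ l.length = r ∧ (m ++ w :: l).Nodup ∧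
      IsMedianOrder T (m ++ w :: l) := by
  obtain ⟨L, hL, hmed⟩ := exists_isMedianOrder T (Finset.univ : Finset V).toList
  have hlen : L.length = n + (r + 1) := by rw [hL.length_eq, Finset.length_toList]; exact hV
  have hnd : L.Nodup := hL.nodup_iff.2 (Finset.nodup_toList _)
  obtain ⟨w, l, hwl⟩ : ∃ w l, L.drop n = w :: l := by
    cases h : L.drop n with
    | nil => rw [List.drop_eq_nil_iff] at h; omega
    | cons w l => exact ⟨w, l, rfl⟩
  have hsplit : L.take n ++ w :: l = L := by rw [← hwl, List.take_append_drop]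
  refine ⟨L.take n, w, l, by simp; omega, ?_, by rw [hsplit]; exact hnd,
    by rw [hsplit]; exact hmed⟩
  have := congrArg List.length hwl
  simp only [List.length_drop, List.length_cons] at this
  omega

theorem isChain_of_isMedianOrder (hT : IsTournament T) {m l : List V}
    (h : IsMedianOrder T (m ++ l)) (hl : (m ++ l).Nodup) : l.IsChain T.Adj :=
  IsMedianOrder.isChain hT hl.of_append_right m h

theorem notMem_toFinset_of_nodup_append {m l : List V} (hl : (m ++ l).Nodup) :
    ∀ z ∈ l, z ∉ m.toFinset := fun z hz hzm =>
  (List.nodup_append.1 hl).2.2 z (List.mem_toFinset.1 hzm) z hz rfl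

/-- The case in which the path leaves the cycle from a sink. -/
theorem containsCopy_of_odd [Fintype V] (hT : IsTournament T) (hk : 54 ≤ k) {r : ℕ}
    (hV : Fintype.card V = 2 * k + (r + 1)) (v : Fin (2 * k)) (hv : ¬ Even v.val) :
    ContainsCopy T (cycleWithPath k (r + 1) v) := by
  obtain ⟨m, u, l', hm, hl', hnd, hmed⟩ := exists_medianOrder_split T (n := 2 * k - 1)
    (r := r + 1) (by omega)
  obtain ⟨w, l, rfl⟩ : ∃ w l, l' = w :: l := by
    cases l' with
    | nil => simp at hl'
    | cons w l => exact ⟨w, l, rfl⟩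
  obtain rfl : l.length = r := by simpa using hl'
  obtain ⟨f, h0, him, hf⟩ := exists_antiCycle_of_isMedianOrder hT hk hmed hnd hm
  have hch := isChain_of_isMedianOrder hT hmed hnd
  rw [List.isChain_cons_cons] at hch
  have hnd' := hnd
  rw [List.append_cons] at hnd'
  refine containsCopy_cycleWithPath (i₀ := 0) v
    (toFinset_card_concat (by omega) hm hnd'.of_append_left) him hf (by omega) (by simp [hv])
    (by rw [h0]; exact hch.1) hnd'.of_append_right hch.2 (notMem_toFinset_of_nodup_append hnd')

/-- The case in which the path leaves the cycle from a source. -/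
theorem containsCopy_of_even [Fintype V] (hT : IsTournament T) (hk : 54 ≤ k) {r : ℕ}
    (hV : Fintype.card V = 2 * k + (r + 1)) (v : Fin (2 * k)) (hv : Even v.val) :
    ContainsCopy T (cycleWithPath k (r + 1) v) := by
  obtain ⟨m, w, l, hm, rfl, hnd, hmed⟩ := exists_medianOrder_split T hV
  by_cases htight : ∀ m' x, (m' ++ [x]).Perm (m ++ [w]) → IsMedianOrder T (m' ++ x :: l) →
      m'.countP (fun a => T.Adj a x) ≤ m'.countP (fun a => T.Adj x a)
  · set M := (m ++ [w]).toFinset with hM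
    have hnd' := hnd
    rw [List.append_cons] at hnd'
    have hMc : M.card = 2 * k + 1 := by
      rw [hM, List.toFinset_card_of_nodup hnd'.of_append_left]
      simp [hm]
    -- every vertex of the first block is its last vertex in some median order
    have hlast : ∀ x ∈ M, ∃ m', (m' ++ [x]).Perm (m ++ [w]) ∧ IsMedianOrder T (m' ++ x :: l) := by
      intro x hx
      obtain ⟨m₁, m₂, h12⟩ := List.append_of_mem (List.mem_toFinset.1 hx)
      have h := isMedianOrder_rotate (by simpa using hmed) htight (m₁ ++ [x]) m₂ (by simpa using h12)
      refine ⟨m₂ ++ m₁, ?_, by simpa using h⟩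
      rw [h12, List.append_assoc]
      exact List.perm_append_comm.trans (by simp)
    have hperm : ∀ {m' x}, (m' ++ [x]).Perm (m ++ [w]) → (m' ++ x :: l).Perm (m ++ w :: l) := by
      intro m' x h
      rw [List.append_cons m', List.append_cons m]
      exact h.append_right l
    have herase : ∀ {m' x}, (m' ++ [x]).Perm (m ++ [w]) → m'.toFinset = M.erase x := by
      intro m' x h
      have hn := h.nodup_iff.2 hnd'.of_append_left
      rw [hM, ← List.toFinset_eq_of_perm _ _ h]
      ext z
      simp only [List.mem_toFinset, Finset.mem_erase, List.mem_append, List.mem_singleton]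
      constructor
      · intro hz
        exact ⟨(List.nodup_append.1 hn).2.2 z hz x (by simp), Or.inl hz⟩
      · tauto
    have hreg : ∀ x ∈ M, (nbrs T true x M).card = k := by
      intro x hx
      obtain ⟨m', hp, hmed'⟩ := hlast x hx
      have hn := (hperm hp).nodup_iff.2 hnd
      have hle := htight m' x hp hmed'
      have hge := hmed'.countP_le (l₀ := [])
      have hxm : x ∉ m' := fun h => (List.nodup_append.1 hn).2.2 x h x (by simp) rfl
      have hsum := countP_add_countP hT hxm
      have hlen := hp.length_eq
      simp only [List.length_append, List.length_singleton, hm] at hlen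
      rw [countP_adj_left hn.of_append_left, herase hp] at hle hge hsum
      have : nbrs T true x M = nbrs T true x (M.erase x) := by
        ext z
        simp only [mem_nbrs, Finset.mem_erase]
        constructor
        · exact fun h => ⟨⟨(h.2.ne hT).symm, h.1⟩, h.2⟩
        · tauto
      rw [this]
      omega
    obtain ⟨x, hx, f, him, hf, hadj⟩ := exists_source_adj_of_regular hT hk hMc hreg
    obtain ⟨m', hp, hmed'⟩ := hlast x hx
    have hn := (hperm hp).nodup_iff.2 hnd
    refine containsCopy_cycleWithPath (i₀ := 0) v (by rw [Finset.card_erase_of_mem hx, hMc]; omega)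
      him hf (by omega) (by simp [hv]) hadj hn.of_append_right
      (isChain_of_isMedianOrder hT hmed' hn) ?_
    rw [← herase hp]
    exact notMem_toFinset_of_nodup_append hn
  · push Not at htight
    obtain ⟨m', x, hp, hmed', hlt⟩ := htight
    have hn : (m' ++ x :: l).Nodup := by
      refine (List.Perm.nodup_iff ?_).2 hnd
      rw [List.append_cons m', List.append_cons m]
      exact hp.append_right l
    have hlen := hp.length_eq
    simp only [List.length_append, List.length_singleton, hm] at hlen
    obtain ⟨f, him, hf, i, hi, hio, hadj⟩ :=
      exists_source_adj hT hk hmed' hn (by omega) hlt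
    exact containsCopy_cycleWithPath v
      (by rw [List.toFinset_card_of_nodup hn.of_append_left]; omega) him hf hi
      (by simp [hv, hio]) hadj hn.of_append_right (isChain_of_isMedianOrder hT hmed' hn)
      (notMem_toFinset_of_nodup_append hn)

end MedianCycle

/-! ### The oriented Ramsey number -/

section RamseyNumber

/-- A digraph on `n` vertices contained in all tournaments of order `n` has oriented Ramsey number
`n`: smaller tournaments have too few vertices. -/
theorem orientedRamseyNumber_eq_card {V : Type*} [Fintype V] (H : Digraph V)
    (h : ∀ T : Digraph (Fin (Fintype.card V)), IsTournament T → ContainsCopy T H) :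
    orientedRamseyNumber H = (Fintype.card V : ℕ∞) := by
  refine le_antisymm (sInf_le ⟨_, h, rfl⟩) (le_sInf ?_)
  rintro _ ⟨N, hN, rfl⟩
  obtain ⟨f, -⟩ := hN ⟨fun a b => a < b⟩
    ⟨fun a => lt_irrefl a, fun a b hab => by
      change a < b ↔ ¬ b < a
      rw [not_lt]
      exact ⟨le_of_lt, fun h => lt_of_le_of_ne h hab⟩⟩
  have := Fintype.card_le_of_embedding f
  rw [Fintype.card_fin] at this
  exact Nat.cast_le.2 this

theorem card_cycleWithPath (k ℓ : ℕ) :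
    Fintype.card (Fin (2 * k) ⊕ {w : Fin (ℓ + 1) // w ≠ 0}) = 2 * k + ℓ := by
  rw [Fintype.card_sum, Fintype.card_fin, Fintype.card_subtype_compl]
  simp

theorem even_of_outDegree_ne_zero {k : ℕ} {v : Fin (2 * k)}
    (h : outDegree (antidirectedCycle k) v ≠ 0) : Even v.val := by
  obtain ⟨w, hw⟩ := Set.nonempty_of_ncard_ne_zero h
  exact hw.1

theorem not_even_of_inDegree_ne_zero {k : ℕ} {v : Fin (2 * k)}
    (h : inDegree (antidirectedCycle k) v ≠ 0) : ¬ Even v.val := by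
  obtain ⟨w, hw, hw'⟩ := Set.nonempty_of_ncard_ne_zero h
  have hmod : ∀ a : ℕ, a % (2 * k) % 2 = a % 2 := fun a =>
    Nat.mod_mod_of_dvd _ (Dvd.intro k rfl)
  rw [Nat.even_iff] at hw ⊢
  rcases hw' with h | h
  · have := hmod (w.val + 1)
    rw [← h] at this
    omega
  · have := hmod (v.val + 1)
    rw [← h] at this
    omega

end RamseyNumber
end OrientedRamsey

theorem theorem1 (k ℓ : ℕ) (hk : 54 ≤ k) (hℓ : 1 ≤ ℓ) :
    (∀ v : Fin (2 * k),
      OrientedRamsey.outDegree (OrientedRamsey.antidirectedCycle k) v = 2 →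
        (∀ (W : Type*) [Fintype W] (T : Digraph W), OrientedRamsey.IsTournament T →
          Fintype.card W = 2 * k + ℓ →
            OrientedRamsey.ContainsCopy T (OrientedRamsey.cycleWithPath k ℓ v)) ∧
        OrientedRamsey.orientedRamseyNumber (OrientedRamsey.cycleWithPath k ℓ v)
          = ((2 * k + ℓ : ℕ) : ℕ∞)) ∧
    (∀ v : Fin (2 * k),
      OrientedRamsey.inDegree (OrientedRamsey.antidirectedCycle k) v = 2 →
        (∀ (W : Type*) [Fintype W] (T : Digraph W), OrientedRamsey.IsTournament T →
          Fintype.card W = 2 * k + ℓ →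
            OrientedRamsey.ContainsCopy T (OrientedRamsey.cycleWithPath k ℓ v)) ∧
        OrientedRamsey.orientedRamseyNumber (OrientedRamsey.cycleWithPath k ℓ v)
          = ((2 * k + ℓ : ℕ) : ℕ∞)) := by
  obtain ⟨r, rfl⟩ : ∃ r, ℓ = r + 1 := ⟨ℓ - 1, by omega⟩
  have hcard := OrientedRamsey.card_cycleWithPath k (r + 1)
  refine ⟨fun v hv => ?_, fun v hv => ?_⟩
  · have hev := OrientedRamsey.even_of_outDegree_ne_zero (v := v) (by omega)
    refine ⟨fun W _ T hT hW => OrientedRamsey.containsCopy_of_even hT hk hW v hev, ?_⟩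
    rw [OrientedRamsey.orientedRamseyNumber_eq_card, hcard]
    exact fun T hT => OrientedRamsey.containsCopy_of_even hT hk (by rw [Fintype.card_fin, hcard])
      v hev
  · have hodd := OrientedRamsey.not_even_of_inDegree_ne_zero (v := v) (by omega)
    refine ⟨fun W _ T hT hW => OrientedRamsey.containsCopy_of_odd hT hk hW v hodd, ?_⟩
    rw [OrientedRamsey.orientedRamseyNumber_eq_card, hcard]
    exact fun T hT => OrientedRamsey.containsCopy_of_odd hT hk (by rw [Fintype.card_fin, hcard])
      v hodd
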